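/- **Theorem.** Let $H_1,H_2,H_3$ be real Hilbert spaces. For $j=1,2$ let $K_j\subseteq H_j$ be nonempty, closed and convex, let $D_j:H_j\to H_3$ be bounded and linear with adjoint $D_j^*$, put $L_j=\|D_j^*D_j\|$, and let $T_j:H_j\to H_j$ be monotone on $K_j$, i.e. $\langle T_jx-T_jy,x-y\rangle\ge 0$ for $x,y\in K_j$, and continuous along segments of $K_j$ in the sense that $\lim_{s\downarrow 0}\langle T_j(x+s(z-x)),z-x\rangle=\langle T_jx,z-x\rangle$ for $x,z\in K_j$ (for instance hemicontinuous). Let $$VI(K_j,T_j)=\{x\in K_j:\langle T_jx,t-x\rangle\ge 0\ \ \forall t\in K_j\},$$ $$\Gamma_2=\{(x^*,y^*)\in VI(K_1,T_1)\times VI(K_2,T_2): D_1x^*=D_2y^*\}$$ (the solution set of the split variational inequality problem, SVIP), and assume $\Gamma_2\ne\emptyset$. Put $g_j(x,t)=\langle T_jx,t-x\rangle$, fix $\lambda>0$ and let $$R_{\lambda,g_j}(q)=\Big\{y\in K_j: g_j(y,t)+\tfrac1\lambda\langle t-y,y-q\rangle\ge 0\ \ \forall t\in K_j\Big\},\qquad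 q\in H_j.$$ Then $R_{\lambda,g_j}(q)$ consists of exactly one point for every $q\in H_j$ $(j=1,2)$, so that $R_j:=R_{\lambda,g_j}$ is a map $H_j\to H_j$, and the SVIP is a split equality fixed-point problem: $$\Gamma_2=\{(x^*,y^*)\in \mathrm{Fix}(R_1)\times \mathrm{Fix}(R_2): D_1x^*=D_2y^*\}.$$ Assume moreover that $R_1-I$ and $R_2-I$ are demiclosed at zero (if $q_n\rightharpoonup q$ weakly and $(R_j-I)q_n\to0$ strongly, then $(R_j-I)q=0$). Let $0<\eta<\zeta<\frac{1}{1+\sqrt{1+L^2}}$ with $L=1$, and $$U=(1-\eta)I+\eta R_1((1-\zeta)I+\zeta R_1),\qquad V=(1-\eta)I+\eta R_2((1-\zeta)I+\zeta R_2).$$ Let $0<a<\alpha_n<1$ for all $n$ and a constant $a$, and let $\tau_n>0$ satisfy $\tau_n(L_1+L_2)<2$ for all $n$, $\lim_{n\to\infty}\tau_n=0$ and $\sum_n\tau_n=\infty$. For arbitrary $(x_0,y_0)\in H_1\times H_2$ let, for $n\ge 0$, $$v_n=(1-\tau_n)x_n+\tau_nUx_n+\tau_nD_1^*(D_2y_n-D_1x_n),\qquad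 x_{n+1}=(1-\alpha_n)v_n+\alpha_nUv_n,$$ $$w_n=(1-\tau_n)y_n+\tau_nVy_n+\tau_nD_2^*(D_1x_n-D_2y_n),\qquad y_{n+1}=(1-\alpha_n)w_n+\alpha_nVw_n.$$ Then there is $(x^*,y^*)\in\Gamma_2$ such that $x_n\rightharpoonup x^*$ and $y_n\rightharpoonup y^*$ weakly. -/

import Mathlib

open Filter Topology
open scoped InnerProductSpace

namespace SplitVI

noncomputable section

variable {H : Type*} [NormedAddCommGroup H] [InnerProductSpace ℝ H]

/-- Weak convergence of a sequence. -/
def WeaklyConverges (x : ℕ → H) (p : H) : Prop :=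
  Tendsto (fun n => toWeakSpace ℝ H (x n)) atTop (𝓝 (toWeakSpace ℝ H p))

/-- `S` is demiclosed at zero: if `xₙ` converges weakly to `p` and `S xₙ` converges strongly
to `0`, then `S p = 0`. -/
def DemiclosedAtZero (S : H → H) : Prop :=
  ∀ (x : ℕ → H) (p : H), WeaklyConverges x p → Tendsto (fun n => S (x n)) atTop (𝓝 0) → S p = 0

/-- `T` is monotone on `K`. -/
def IsMonotoneOperatorOn (T : H → H) (K : Set H) : Prop :=
  ∀ x ∈ K, ∀ y ∈ K, 0 ≤ ⟪T x - T y, x - y⟫_ℝ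

/-- `T` is continuous along the segments of `K`, in the direction of the segment. -/
def IsRadiallyContinuousOn (T : H → H) (K : Set H) : Prop :=
  ∀ x ∈ K, ∀ z ∈ K,
    Tendsto (fun s : ℝ => ⟪T (x + s • (z - x)), z - x⟫_ℝ) (𝓝[>] 0) (𝓝 ⟪T x, z - x⟫_ℝ)

/-- The solution set `VI(K, T)` of the variational inequality. -/
def viSolutions (K : Set H) (T : H → H) : Set H :=
  {x | x ∈ K ∧ ∀ t ∈ K, 0 ≤ ⟪T x, t - x⟫_ℝ}

/-- The bifunction `g(x, t) = ⟪T x, t - x⟫`. -/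
def viBifunction (T : H → H) (x t : H) : ℝ := ⟪T x, t - x⟫_ℝ

/-- The set of those `y ∈ K` with `g(y, t) + (1/lam) ⟪t - y, y - q⟫ ≥ 0` for all `t ∈ K`. -/
def resolventValues (lam : ℝ) (K : Set H) (g : H → H → ℝ) (q : H) : Set H :=
  {y | y ∈ K ∧ ∀ t ∈ K, 0 ≤ g y t + (1 / lam) * ⟪t - y, y - q⟫_ℝ}

/-- The resolvent `R_{lam, g}`: a point of `resolventValues lam K g q`
(an arbitrary point of `H` if that set is empty). -/
def resolventMap (lam : ℝ) (K : Set H) (g : H → H → ℝ) (q : H) : H :=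
  Classical.epsilon fun y => y ∈ resolventValues lam K g q

/-- The Ishikawa-type map `(1 - η) I + η R ((1 - ζ) I + ζ R)`. -/
def ishikawaMap (η ζ : ℝ) (R : H → H) (x : H) : H :=
  (1 - η) • x + η • R ((1 - ζ) • x + ζ • R x)

variable {H₁ H₂ H₃ : Type*}
  [NormedAddCommGroup H₁] [InnerProductSpace ℝ H₁]
  [NormedAddCommGroup H₂] [InnerProductSpace ℝ H₂]
  [NormedAddCommGroup H₃] [InnerProductSpace ℝ H₃]

/-- The solution set of the split variational inequality problem. -/
def svipSolutions (K₁ : Set H₁) (K₂ : Set H₂) (T₁ : H₁ → H₁) (T₂ : H₂ → H₂)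
    (D₁ : H₁ →L[ℝ] H₃) (D₂ : H₂ →L[ℝ] H₃) : Set (H₁ × H₂) :=
  {p | p.1 ∈ viSolutions K₁ T₁ ∧ p.2 ∈ viSolutions K₂ T₂ ∧ D₁ p.1 = D₂ p.2}

/-- The solution set of the split equality fixed-point problem. -/
def sefppSolutions (R₁ : H₁ → H₁) (R₂ : H₂ → H₂)
    (D₁ : H₁ →L[ℝ] H₃) (D₂ : H₂ →L[ℝ] H₃) : Set (H₁ × H₂) :=
  {p | p.1 ∈ Function.fixedPoints R₁ ∧ p.2 ∈ Function.fixedPoints R₂ ∧ D₁ p.1 = D₂ p.2}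

end

end SplitVI

/-! The resolvents come from a Minty-type argument. The relation λT − q + N_K, with N_K the normal
cone, is monotone, and `exists_monotone_extension_neg` supplies y with (y, −y) monotonically related
to all of it. The normal cone forces y ∈ K, and moving along segments of K yields the resolvent
inequality. Monotonicity makes the resolvent single-valued and nonexpansive; its fixed points solve
the variational inequality.

On the Hilbert product put z = (x, y), Az = D₁x − D₂y and S = U × V, so that both iterations become
one: a τ_n-step of S combined with the gradient step −τ_n A*Az, then an α_n-step of S. With κ = (1 −
η)/η, for every q fixed by R₁ × R₂ and all large n, ‖z_{n+1} − q‖² + aκ‖Sv_n − v_n‖² + τ_n‖Az_n‖² ≤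
‖z_n − q‖² + 2τ_n⟨Aq, Az_n⟩. Taking Aq = 0 shows Sv_n − v_n → 0, so demiclosedness makes every weak
cluster point of z_n a fixed point. As τ_n → 0, however, only Σ τ_n‖Az_n‖² < ∞ follows, and cluster
points need not obviously lie in ker A, so Opial's lemma does not apply directly.
`exists_weaklyConverges_of_quasiFejer` closes this gap: Σ τ_n = ∞ gives one cluster point p in ker
A, and a second one q is impossible because, below a suitable level of ‖z_n − q‖², ‖Az_n‖ stays away
from 0 and the drift is dominated by the summable τ_n‖Az_n‖². -/

namespace SplitVI

/-! ### Existence, uniqueness and nonexpansiveness of the resolvent. -/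

section Resolvent

variable {H : Type*} [NormedAddCommGroup H] [InnerProductSpace ℝ H]

/-- On the convex hull of the graph of a monotone relation, extended by the pairing, the last
coordinate dominates the pairing. -/
theorem inner_le_of_mem_convexHull_graph {G : Set (H × H)}
    (hG : ∀ p ∈ G, ∀ p' ∈ G, 0 ≤ ⟪p.1 - p'.1, p.2 - p'.2⟫_ℝ) {e : H × H × ℝ}
    (he : e ∈ convexHull ℝ ((fun p : H × H => (p.1, p.2, ⟪p.1, p.2⟫_ℝ)) '' G)) :
    ⟪e.1, e.2.1⟫_ℝ ≤ e.2.2 := by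
  -- The symmetrised inequality is affine in each argument separately, so it passes from graph ×
  -- graph to hull × graph and then to hull × hull; the diagonal gives the claim.
  have hconv : ∀ b : H × H × ℝ, Convex ℝ {e : H × H × ℝ |
      ⟪e.1, b.2.1⟫_ℝ + ⟪b.1, e.2.1⟫_ℝ ≤ e.2.2 + b.2.2} := by
    intro b x hx y hy s t hs ht hst
    simp only [Set.mem_ofPred_eq, Prod.fst_add, Prod.snd_add, Prod.smul_fst, Prod.smul_snd,
      inner_add_left, inner_add_right, real_inner_smul_left, real_inner_smul_right,
      smul_eq_mul] at hx hy ⊢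
    have h1 := mul_le_mul_of_nonneg_left hx hs
    have h2 := mul_le_mul_of_nonneg_left hy ht
    have h3 : b.2.2 = s * b.2.2 + t * b.2.2 := by rw [← add_mul, hst, one_mul]
    linarith
  have step : ∀ p ∈ G, ⟪e.1, p.2⟫_ℝ + ⟪p.1, e.2.1⟫_ℝ ≤ e.2.2 + ⟪p.1, p.2⟫_ℝ := by
    intro p hp
    refine convexHull_min ?_ (hconv (p.1, p.2, ⟪p.1, p.2⟫_ℝ)) he
    rintro _ ⟨p', hp', rfl⟩
    have := hG p' hp' p hp
    simp only [Set.mem_ofPred_eq, inner_sub_left, inner_sub_right] at this ⊢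
    linarith
  have h := convexHull_min (t := {x : H × H × ℝ |
      ⟪x.1, e.2.1⟫_ℝ + ⟪e.1, x.2.1⟫_ℝ ≤ x.2.2 + e.2.2}) ?_ (hconv e) he
  · simp only [Set.mem_ofPred_eq] at h
    linarith
  · rintro _ ⟨p, hp, rfl⟩
    have := step p hp
    simp only [Set.mem_ofPred_eq]
    linarith

/-- A monotone relation `G` on a Hilbert space extends monotonically by some pair `(y, -y)`. -/
theorem exists_monotone_extension_neg [CompleteSpace H] {G : Set (H × H)} (hne : G.Nonempty)
    (hG : ∀ p ∈ G, ∀ p' ∈ G, 0 ≤ ⟪p.1 - p'.1, p.2 - p'.2⟫_ℝ) :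
    ∃ y : H, ∀ p ∈ G, 0 ≤ ⟪p.1 - y, p.2 + y⟫_ℝ := by
  set C := convexHull ℝ ((fun p : H × H => (p.1, p.2, ⟪p.1, p.2⟫_ℝ)) '' G) with hC
  have hCc : Convex ℝ C := convex_convexHull _ _
  have hsub : ∀ p ∈ G, (p.1, p.2, ⟪p.1, p.2⟫_ℝ) ∈ C := fun p hp =>
    subset_convexHull ℝ _ ⟨p, hp, rfl⟩
  -- `M e` is ‖e.1 + e.2.1‖²/4 plus the nonnegative gap `e.2.2 - ⟪e.1, e.2.1⟫`. It is strongly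
  -- convex only in the difference `e.1 - e.2.1`, so only the differences of a minimizing sequence
  -- converge.
  let M : H × H × ℝ → ℝ := fun e => e.2.2 + ‖e.1 - e.2.1‖ ^ 2 / 4
  have hM0 : ∀ e ∈ C, 0 ≤ M e := by
    intro e he
    have h1 := inner_le_of_mem_convexHull_graph hG he
    have h2 : ‖e.1 + e.2.1‖ ^ 2 = ‖e.1 - e.2.1‖ ^ 2 + 4 * ⟪e.1, e.2.1⟫_ℝ := by
      rw [norm_add_sq_real, norm_sub_sq_real]; ring
    have h3 := sq_nonneg ‖e.1 + e.2.1‖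
    simp only [M]
    linarith
  have hMseg : ∀ e e' : H × H × ℝ, ∀ s : ℝ, M ((1 - s) • e + s • e') =
      (1 - s) * M e + s * M e' - s * (1 - s) * ‖(e.1 - e.2.1) - (e'.1 - e'.2.1)‖ ^ 2 / 4 := by
    intro e e' s
    have h : ((1 - s) • e + s • e').1 - ((1 - s) • e + s • e').2.1 =
        (1 - s) • (e.1 - e.2.1) + s • (e'.1 - e'.2.1) := by
      simp only [Prod.fst_add, Prod.snd_add, Prod.smul_fst, Prod.smul_snd]
      module
    simp only [M]
    rw [h, norm_add_sq_real, norm_sub_sq_real (e.1 - e.2.1), norm_smul, norm_smul,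
      real_inner_smul_left, real_inner_smul_right, mul_pow, mul_pow, Real.norm_eq_abs,
      Real.norm_eq_abs, sq_abs, sq_abs]
    simp only [Prod.snd_add, Prod.smul_snd, smul_eq_mul]
    ring
  have hCne : (M '' C).Nonempty := by
    obtain ⟨p, hp⟩ := hne
    exact ⟨_, _, hsub p hp, rfl⟩
  have hbdd : BddBelow (M '' C) := ⟨0, by rintro _ ⟨e, he, rfl⟩; exact hM0 e he⟩
  set m := sInf (M '' C) with hm
  have hmle : ∀ e ∈ C, m ≤ M e := fun e he => csInf_le hbdd ⟨e, he, rfl⟩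
  have hm0 : 0 ≤ m := le_csInf hCne (by rintro _ ⟨e, he, rfl⟩; exact hM0 e he)
  have hex : ∀ n : ℕ, ∃ e ∈ C, M e < m + 1 / ((n : ℝ) + 1) := by
    intro n
    obtain ⟨_, ⟨e, he, rfl⟩, hlt⟩ := exists_lt_of_csInf_lt hCne
      (show sInf (M '' C) < m + 1 / ((n : ℝ) + 1) from lt_add_of_pos_right _ (by positivity))
    exact ⟨e, he, hlt⟩
  choose e heC heM using hex
  let w : ℕ → H := fun n => (e n).1 - (e n).2.1
  have hb0 : Tendsto (fun n : ℕ => 1 / ((n : ℝ) + 1)) atTop (𝓝 0) :=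
    tendsto_one_div_add_atTop_nhds_zero_nat
  -- Midpoint comparison: s = 1/2 in `hMseg` gives the coefficient 1/16.
  have hw : ∀ N n k : ℕ, N ≤ n → N ≤ k → ‖w n - w k‖ ^ 2 ≤ 16 * (1 / ((N : ℝ) + 1)) := by
    intro N n k hn hk
    have h1 := hmle _ (hCc (heC n) (heC k) (show (0 : ℝ) ≤ 1 - 1 / 2 by norm_num)
      (by norm_num : (0 : ℝ) ≤ 1 / 2) (by norm_num))
    rw [hMseg] at h1
    have h2 := heM n
    have h3 := heM k
    have h4 := Nat.one_div_le_one_div (α := ℝ) hn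
    have h5 := Nat.one_div_le_one_div (α := ℝ) hk
    simp only [w]
    linarith
  have hcauchy : CauchySeq w := by
    refine cauchySeq_of_le_tendsto_0 (fun N : ℕ => Real.sqrt (16 * (1 / ((N : ℝ) + 1)))) ?_ ?_
    · intro n k N hn hk
      rw [dist_eq_norm]
      exact Real.le_sqrt_of_sq_le (hw N n k hn hk)
    · have := (hb0.const_mul 16).sqrt
      simpa using this
  obtain ⟨w₀, hw₀⟩ := cauchySeq_tendsto_of_complete hcauchy
  have hMlim : Tendsto (fun n => M (e n)) atTop (𝓝 m) := by
    refine tendsto_of_tendsto_of_tendsto_of_le_of_le tendsto_const_nhds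
      (by simpa using hb0.const_add m) (fun n => hmle _ (heC n)) (fun n => (heM n).le)
  -- Moving from the minimizing sequence towards `b` and letting s ↓ 0 gives M b − m ≥ ‖w₀ − (p.1 −
  -- p.2)‖²/4. After dropping m ≥ 0 this is the required inequality for w₀/2.
  refine ⟨(1 / 2 : ℝ) • w₀, fun p hp => ?_⟩
  set b : H × H × ℝ := (p.1, p.2, ⟪p.1, p.2⟫_ℝ) with hb
  have hseg : ∀ s : ℝ, 0 < s → s ≤ 1 →
      0 ≤ M b - m - (1 - s) * ‖w₀ - (p.1 - p.2)‖ ^ 2 / 4 := by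
    intro s hs hs1
    have hlim : Tendsto (fun n => (1 - s) * M (e n) + s * M b
        - s * (1 - s) * ‖w n - (p.1 - p.2)‖ ^ 2 / 4) atTop
        (𝓝 ((1 - s) * m + s * M b - s * (1 - s) * ‖w₀ - (p.1 - p.2)‖ ^ 2 / 4)) :=
      ((hMlim.const_mul _).add_const _).sub
        ((((hw₀.sub_const _).norm.pow 2).const_mul _).div_const _)
    have h := ge_of_tendsto' hlim (fun n => by
      have := hmle _ (hCc (heC n) (hsub p hp) (sub_nonneg.2 hs1) hs.le (by ring))
      rwa [hMseg] at this)
    have h' : 0 ≤ s * (M b - m - (1 - s) * ‖w₀ - (p.1 - p.2)‖ ^ 2 / 4) := by linarith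
    exact nonneg_of_mul_nonneg_right h' hs
  have hfin : 0 ≤ M b - m - (1 - 0) * ‖w₀ - (p.1 - p.2)‖ ^ 2 / 4 := by
    have hcont : Tendsto (fun s : ℝ => M b - m - (1 - s) * ‖w₀ - (p.1 - p.2)‖ ^ 2 / 4) (𝓝[>] 0)
        (𝓝 (M b - m - (1 - 0) * ‖w₀ - (p.1 - p.2)‖ ^ 2 / 4)) :=
      (Continuous.tendsto (by fun_prop) 0).mono_left nhdsWithin_le_nhds
    refine ge_of_tendsto hcont ?_
    filter_upwards [Ioc_mem_nhdsGT (zero_lt_one (α := ℝ))] with s hs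
    exact hseg s hs.1 hs.2
  have hMb : M b = ⟪p.1, p.2⟫_ℝ + ‖p.1 - p.2‖ ^ 2 / 4 := rfl
  rw [hMb, norm_sub_sq_real w₀] at hfin
  have : ⟪p.1 - (1 / 2 : ℝ) • w₀, p.2 + (1 / 2 : ℝ) • w₀⟫_ℝ =
      ⟪p.1, p.2⟫_ℝ + 1 / 2 * ⟪w₀, p.1 - p.2⟫_ℝ - ‖w₀‖ ^ 2 / 4 := by
    rw [inner_sub_left, inner_add_right, inner_add_right, inner_sub_right,
      real_inner_smul_left, real_inner_smul_right, real_inner_smul_left, real_inner_smul_right,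
      real_inner_self_eq_norm_sq, real_inner_comm p.1 w₀]
    ring
  linarith

/-- **Existence** for the strongly monotone variational inequality defining the resolvent. -/
theorem resolventValues_nonempty [CompleteSpace H] {K : Set H} (hK : K.Nonempty)
    (hKc : IsClosed K) (hKv : Convex ℝ K) {T : H → H} (hT : IsMonotoneOperatorOn T K)
    (hTc : IsRadiallyContinuousOn T K) {lam : ℝ} (hlam : 0 < lam) (q : H) :
    (resolventValues lam K (viBifunction T) q).Nonempty := by
  let G : Set (H × H) := {p | p.1 ∈ K ∧ ∃ ν : H, (∀ s ∈ K, ⟪ν, s - p.1⟫_ℝ ≤ 0) ∧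
    p.2 = lam • T p.1 - q + ν}
  have hGne : G.Nonempty := by
    obtain ⟨t, ht⟩ := hK
    exact ⟨(t, lam • T t - q + 0), ht, 0, by simp, rfl⟩
  have hGm : ∀ p ∈ G, ∀ p' ∈ G, 0 ≤ ⟪p.1 - p'.1, p.2 - p'.2⟫_ℝ := by
    rintro ⟨t, u⟩ ⟨ht, ν, hν, hu⟩ ⟨t', u'⟩ ⟨ht', ν', hν', hu'⟩
    simp only at ht ht' hν hν' hu hu' ⊢
    subst hu hu'
    have h1 := mul_nonneg hlam.le (hT t ht t' ht')
    have h2 := hν t' ht'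
    have h3 := hν' t ht
    have e : lam • T t - q + ν - (lam • T t' - q + ν') = lam • (T t - T t') + (ν - ν') := by
      module
    rw [e, real_inner_comm, inner_add_left, real_inner_smul_left]
    have e2 : ⟪ν - ν', t - t'⟫_ℝ = -⟪ν, t' - t⟫_ℝ - ⟪ν', t - t'⟫_ℝ := by
      rw [inner_sub_left, ← neg_sub t' t, inner_neg_right]
    linarith
  obtain ⟨y, hy⟩ := exists_monotone_extension_neg hGne hGm
  have hyK : y ∈ K := by
    obtain ⟨t, ht, hmin⟩ := exists_norm_eq_iInf_of_complete_convex hK hKc.isComplete hKv y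
    rw [norm_eq_iInf_iff_real_inner_le_zero hKv ht] at hmin
    by_contra hcon
    have hpos : 0 < ‖t - y‖ ^ 2 := by
      have : t - y ≠ 0 := fun h => hcon (by rw [← sub_eq_zero.1 h]; exact ht)
      positivity
    set c := ⟪t - y, lam • T t - q + y⟫_ℝ with hc
    -- With `t` the projection of `y` on `K`, `y - t` is normal at `t`; this multiple is large
    -- enough that the pairing becomes c − (|c| + 1) < 0.
    set r := (|c| + 1) / ‖t - y‖ ^ 2 with hr
    have hr0 : 0 ≤ r := by positivity
    have h := hy (t, lam • T t - q + r • (y - t)) ⟨ht, r • (y - t), fun s hs => by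
      rw [real_inner_smul_left]
      exact mul_nonpos_of_nonneg_of_nonpos hr0 (hmin s hs), rfl⟩
    have e : lam • T t - q + r • (y - t) + y = (lam • T t - q + y) - r • (t - y) := by module
    simp only at h
    rw [e, inner_sub_right, real_inner_smul_right, real_inner_self_eq_norm_sq, ← hc, hr,
      div_mul_cancel₀ _ hpos.ne'] at h
    linarith [le_abs_self c]
  refine ⟨y, hyK, fun t ht => ?_⟩
  -- Minty's trick: test with the zero normal vector at points of the segment, divide by s, and let
  -- s ↓ 0.
  have hmem : ∀ s : ℝ, 0 < s → s ≤ 1 → y + s • (t - y) ∈ K := fun s hs hs1 =>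
    hKv.add_smul_sub_mem hyK ht ⟨hs.le, hs1⟩
  have hpos : ∀ s : ℝ, 0 < s → s ≤ 1 →
      0 ≤ lam * ⟪T (y + s • (t - y)), t - y⟫_ℝ + ⟪t - y, y - q⟫_ℝ := by
    intro s hs hs1
    have h := hy (y + s • (t - y), lam • T (y + s • (t - y)) - q + 0)
      ⟨hmem s hs hs1, 0, by simp, rfl⟩
    have e : lam • T (y + s • (t - y)) - q + 0 + y = lam • T (y + s • (t - y)) + (y - q) := by
      module
    simp only [add_sub_cancel_left] at h
    rw [e, real_inner_smul_left] at h
    have h' := nonneg_of_mul_nonneg_right h hs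
    rwa [inner_add_right, real_inner_smul_right, real_inner_comm] at h'
  have hlim := ((hTc y hyK t ht).const_mul lam).add_const ⟪t - y, y - q⟫_ℝ
  have h0 : 0 ≤ lam * ⟪T y, t - y⟫_ℝ + ⟪t - y, y - q⟫_ℝ := by
    refine ge_of_tendsto hlim ?_
    filter_upwards [Ioc_mem_nhdsGT (zero_lt_one (α := ℝ))] with s hs
    exact hpos s hs.1 hs.2
  have : viBifunction T y t + 1 / lam * ⟪t - y, y - q⟫_ℝ =
      (lam * ⟪T y, t - y⟫_ℝ + ⟪t - y, y - q⟫_ℝ) / lam := by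
    unfold viBifunction
    field_simp
  rw [this]
  positivity

/-- The resolvent values depend nonexpansively on the base point. -/
theorem norm_sub_le_of_mem_resolventValues {K : Set H} {T : H → H}
    (hT : IsMonotoneOperatorOn T K) {lam : ℝ} (hlam : 0 < lam) {q q' y y' : H}
    (hy : y ∈ resolventValues lam K (viBifunction T) q)
    (hy' : y' ∈ resolventValues lam K (viBifunction T) q') : ‖y - y'‖ ≤ ‖q - q'‖ := by
  have h1 := hy.2 y' hy'.1
  have h2 := hy'.2 y hy.1
  have h3 := hT y hy.1 y' hy'.1
  unfold viBifunction at h1 h2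
  have e1 : ⟪T y, y' - y⟫_ℝ + ⟪T y', y - y'⟫_ℝ = -⟪T y - T y', y - y'⟫_ℝ := by
    rw [inner_sub_left, ← neg_sub y y', inner_neg_right]; ring
  have e2 : ⟪y' - y, y - q⟫_ℝ + ⟪y - y', y' - q'⟫_ℝ =
      ⟪y - y', q - q'⟫_ℝ - ‖y - y'‖ ^ 2 := by
    rw [← real_inner_self_eq_norm_sq, ← inner_sub_right, ← neg_sub y y', inner_neg_left,
      ← sub_eq_neg_add, ← inner_sub_right]
    congr 1
    abel
  have h4 : 0 ≤ 1 / lam * (⟪y - y', q - q'⟫_ℝ - ‖y - y'‖ ^ 2) := by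
    rw [← e2, mul_add]; linarith
  have h5 := nonneg_of_mul_nonneg_right h4 (by positivity)
  have h6 := real_inner_le_norm (y - y') (q - q')
  by_contra! hlt
  have h7 : 0 < ‖y - y'‖ := (norm_nonneg _).trans_lt hlt
  nlinarith

theorem resolventValues_eq_singleton [CompleteSpace H] {K : Set H} (hK : K.Nonempty)
    (hKc : IsClosed K) (hKv : Convex ℝ K) {T : H → H} (hT : IsMonotoneOperatorOn T K)
    (hTc : IsRadiallyContinuousOn T K) {lam : ℝ} (hlam : 0 < lam) (q : H) :
    resolventValues lam K (viBifunction T) q = {resolventMap lam K (viBifunction T) q} := by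
  have hmem : resolventMap lam K (viBifunction T) q ∈ resolventValues lam K (viBifunction T) q :=
    Classical.epsilon_spec (p := fun y => y ∈ resolventValues lam K (viBifunction T) q)
      (resolventValues_nonempty hK hKc hKv hT hTc hlam q)
  refine Set.eq_singleton_iff_unique_mem.2 ⟨hmem, fun y hy => ?_⟩
  have := norm_sub_le_of_mem_resolventValues hT hlam hy hmem
  rw [sub_self, norm_zero] at this
  exact sub_eq_zero.1 (norm_le_zero_iff.1 this)

theorem mem_resolventValues_self_iff {K : Set H} {T : H → H} {lam : ℝ} {q : H} :
    q ∈ resolventValues lam K (viBifunction T) q ↔ q ∈ viSolutions K T := by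
  simp [resolventValues, viSolutions, viBifunction]

end Resolvent

/-! ### Weak sequential compactness and weak limits. -/

section WeakConvergence

variable {H : Type*} [NormedAddCommGroup H] [InnerProductSpace ℝ H]

theorem weaklyConverges_iff_inner [CompleteSpace H] {x : ℕ → H} {p : H} :
    WeaklyConverges x p ↔ ∀ h : H, Tendsto (fun n => ⟪h, x n⟫_ℝ) atTop (𝓝 ⟪h, p⟫_ℝ) := by
  have hinj : Function.Injective (topDualPairing ℝ H).flip := by
    intro a b hab
    have : ∀ h : H, ⟪h, a⟫_ℝ = ⟪h, b⟫_ℝ := fun h =>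
      DFunLike.congr_fun hab (InnerProductSpace.toDual ℝ H h)
    exact ext_inner_left ℝ this
  refine (WeakBilin.tendsto_iff_forall_eval_tendsto (topDualPairing ℝ H).flip hinj).trans ?_
  constructor
  · intro h y
    exact h (InnerProductSpace.toDual ℝ H y)
  · intro h f
    obtain ⟨y, rfl⟩ := (InnerProductSpace.toDual ℝ H).surjective f
    exact h y

/-- A bounded sequence in a Hilbert space has a weakly convergent subsequence. -/
theorem exists_subseq_weaklyConverges [CompleteSpace H] {x : ℕ → H} {C : ℝ}
    (hx : ∀ n, ‖x n‖ ≤ C) :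
    ∃ (p : H) (φ : ℕ → ℕ), StrictMono φ ∧ WeaklyConverges (x ∘ φ) p := by
  -- Sequential Banach–Alaoglu needs separability, which the closed span of the sequence has; test
  -- vectors in `H` are projected onto it.
  let M : Submodule ℝ H := (Submodule.span ℝ (Set.range x)).topologicalClosure
  have hsep : TopologicalSpace.IsSeparable (M : Set H) :=
    ((Set.countable_range x).isSeparable.span).closure
  have : TopologicalSpace.SeparableSpace M := hsep.separableSpace
  have hMc : IsClosed (M : Set H) := Submodule.isClosed_topologicalClosure _
  have : CompleteSpace M := hMc.completeSpace_coe
  have hxM : ∀ n, x n ∈ M := fun n =>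
    Submodule.le_topologicalClosure _ (Submodule.subset_span ⟨n, rfl⟩)
  let u : ℕ → M := fun n => ⟨x n, hxM n⟩
  let f : ℕ → WeakDual ℝ M := fun n =>
    StrongDual.toWeakDual (InnerProductSpace.toDual ℝ M (u n))
  have hf : ∀ n, f n ∈ WeakDual.toStrongDual ⁻¹' Metric.closedBall (0 : StrongDual ℝ M) C := by
    intro n
    change InnerProductSpace.toDual ℝ M (u n) ∈ Metric.closedBall (0 : StrongDual ℝ M) C
    rw [mem_closedBall_zero_iff]
    exact ((InnerProductSpace.toDual ℝ M).norm_map (u n)).trans_le (hx n)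
  obtain ⟨g, -, φ, hφ, hlim⟩ := WeakDual.isSeqCompact_closedBall ℝ M 0 C hf
  obtain ⟨p, hp⟩ := (InnerProductSpace.toDual ℝ M).surjective (WeakDual.toStrongDual g)
  refine ⟨p, φ, hφ, weaklyConverges_iff_inner.2 fun h => ?_⟩
  have hev := ((WeakDual.eval_continuous (M.orthogonalProjectionOnto h)).tendsto g).comp hlim
  have e1 : ∀ n, f (φ n) (M.orthogonalProjectionOnto h) = ⟪h, x (φ n)⟫_ℝ := by
    intro n
    change ⟪u (φ n), M.orthogonalProjectionOnto h⟫_ℝ = _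
    rw [Submodule.inner_orthogonalProjectionOnto_eq_of_mem_left, real_inner_comm]
  have e2 : g (M.orthogonalProjectionOnto h) = ⟪h, (p : H)⟫_ℝ := by
    change (WeakDual.toStrongDual g) (M.orthogonalProjectionOnto h) = _
    rw [← hp, InnerProductSpace.toDual_apply_apply,
      Submodule.inner_orthogonalProjectionOnto_eq_of_mem_left, real_inner_comm]
  rw [e2] at hev
  exact hev.congr fun n => e1 n

theorem WeaklyConverges.map [CompleteSpace H] {E : Type*} [NormedAddCommGroup E]
    [InnerProductSpace ℝ E] [CompleteSpace E] {x : ℕ → H} {p : H} (h : WeaklyConverges x p)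
    (A : H →L[ℝ] E) : WeaklyConverges (fun n => A (x n)) (A p) := by
  rw [weaklyConverges_iff_inner] at h ⊢
  intro y
  simpa only [ContinuousLinearMap.adjoint_inner_left] using h (ContinuousLinearMap.adjoint A y)

theorem WeaklyConverges.of_sub_tendsto_zero [CompleteSpace H] {x y : ℕ → H} {p : H}
    (h : WeaklyConverges x p) (hxy : Tendsto (fun n => y n - x n) atTop (𝓝 0)) :
    WeaklyConverges y p := by
  rw [weaklyConverges_iff_inner] at h ⊢
  intro z
  have h1 : Tendsto (fun n => ⟪z, y n - x n⟫_ℝ) atTop (𝓝 ⟪z, (0 : H)⟫_ℝ) :=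
    tendsto_const_nhds.inner hxy
  simpa [inner_sub_right] using (h z).add h1

theorem WeaklyConverges.eq_zero_of_tendsto [CompleteSpace H] {x : ℕ → H} {p : H}
    (h : WeaklyConverges x p) (h0 : Tendsto x atTop (𝓝 0)) : p = 0 := by
  refine ext_inner_left ℝ fun y => ?_
  exact tendsto_nhds_unique (weaklyConverges_iff_inner.1 h y) (tendsto_const_nhds.inner h0)

/-- The distances to two points differ asymptotically, along a weakly convergent sequence, by an
affine function of the weak limit. -/
theorem WeaklyConverges.tendsto_norm_sq_sub [CompleteSpace H] {x : ℕ → H} {r : H}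
    (h : WeaklyConverges x r) (p q : H) :
    Tendsto (fun n => ‖x n - q‖ ^ 2 - ‖x n - p‖ ^ 2) atTop
      (𝓝 (‖r - q‖ ^ 2 - ‖r - p‖ ^ 2)) := by
  have e : ∀ z : H, ‖z - q‖ ^ 2 - ‖z - p‖ ^ 2 = 2 * ⟪p - q, z⟫_ℝ + (‖q‖ ^ 2 - ‖p‖ ^ 2) := by
    intro z
    rw [norm_sub_sq_real, norm_sub_sq_real, inner_sub_left, real_inner_comm p z,
      real_inner_comm q z]
    ring
  simp only [e]
  exact ((weaklyConverges_iff_inner.1 h (p - q)).const_mul 2).add_const _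

theorem weaklyConverges_of_unique_weak_cluster [CompleteSpace H] {x : ℕ → H} {C : ℝ} {p : H}
    (hx : ∀ n, ‖x n‖ ≤ C)
    (hp : ∀ (φ : ℕ → ℕ) (q : H), StrictMono φ → WeaklyConverges (x ∘ φ) q → q = p) :
    WeaklyConverges x p := by
  refine weaklyConverges_iff_inner.2 fun h => tendsto_of_subseq_tendsto fun ns hns => ?_
  obtain ⟨φ, -, hφ⟩ := strictMono_subseq_of_tendsto_atTop hns
  obtain ⟨q, ψ, hψ, hq⟩ := exists_subseq_weaklyConverges (x := x ∘ (ns ∘ φ)) fun n => hx _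
  obtain rfl := hp _ q (hφ.comp hψ) hq
  exact ⟨φ ∘ ψ, weaklyConverges_iff_inner.1 hq h⟩

end WeakConvergence

/-! ### Quasi-Fejér sequences and the relaxed gradient iteration. -/

section Convergence

/-- A real sequence that grows summably while it stays below `b`, and is infinitely often below
some `c < b`, is eventually below `b`. -/
theorem eventually_le_of_summable_growth {g σ : ℕ → ℝ} {b c : ℝ} (hcb : c < b) (hσ : Summable σ)
    (hσ0 : ∀ n, 0 ≤ σ n) (hstep : ∀ᶠ n in atTop, g n ≤ b → g (n + 1) ≤ g n + σ n)
    (hfreq : ∃ᶠ n in atTop, g n < c) : ∀ᶠ n in atTop, g n ≤ b := by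
  have htail : ∀ᶠ n in atTop, ∑' k, σ (k + n) < b - c :=
    (tendsto_sum_nat_add σ).eventually_lt_const (sub_pos.2 hcb)
  obtain ⟨N, hN⟩ := eventually_atTop.1 (hstep.and htail)
  obtain ⟨n, hn, hgn⟩ := frequently_atTop.1 hfreq N
  have hsum : ∀ k, ∑ i ∈ Finset.range k, σ (i + n) < b - c := fun k =>
    ((summable_nat_add_iff n).2 hσ |>.sum_le_tsum _ fun i _ => hσ0 _).trans_lt (hN n hn).2
  -- The tail sum is below b − c, so the bound itself keeps g ≤ b and the growth hypothesis in
  -- force.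
  have key : ∀ k, g (n + k) ≤ c + ∑ i ∈ Finset.range k, σ (i + n) := by
    intro k
    induction k with
    | zero => simpa using hgn.le
    | succ k ih =>
      have h := (hN (n + k) (by omega)).1 (by linarith [hsum k])
      rw [Finset.sum_range_succ, add_comm k n, ← add_assoc]
      linarith
  filter_upwards [eventually_ge_atTop n] with m hm
  obtain ⟨k, rfl⟩ := Nat.exists_eq_add_of_le hm
  linarith [key k, hsum k]

/-- A nonnegative sequence that is eventually decreasing converges. -/
theorem exists_tendsto_of_eventually_succ_le {g : ℕ → ℝ} (h0 : ∀ n, 0 ≤ g n)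
    (hstep : ∀ᶠ n in atTop, g (n + 1) ≤ g n) : ∃ d, Tendsto g atTop (𝓝 d) := by
  obtain ⟨N, hN⟩ := eventually_atTop.1 hstep
  have hanti : Antitone fun n => g (n + N) := antitone_nat_of_succ_le fun n => by
    have := hN (n + N) (by omega)
    rwa [show n + 1 + N = n + N + 1 by omega]
  exact ⟨_, (tendsto_add_atTop_iff_nat N).1
    (tendsto_atTop_ciInf hanti ⟨0, by rintro _ ⟨n, rfl⟩; exact h0 _⟩)⟩

theorem norm_sq_relaxed_sub_le {H : Type*} [NormedAddCommGroup H] [InnerProductSpace ℝ H]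
    {S : H → H} {κ α : ℝ} {z q : H} (hα0 : 0 ≤ α) (hα1 : α ≤ 1)
    (hS : ‖S z - q‖ ^ 2 ≤ ‖z - q‖ ^ 2 - κ * ‖S z - z‖ ^ 2) :
    ‖(1 - α) • z + α • S z - q‖ ^ 2 ≤ ‖z - q‖ ^ 2 - α * κ * ‖S z - z‖ ^ 2 := by
  have e : (1 - α) • z + α • S z - q = (1 - α) • (z - q) + α • (S z - q) := by module
  have e2 : S z - z = (S z - q) - (z - q) := by abel
  have h : ‖(1 - α) • z + α • S z - q‖ ^ 2 =
      (1 - α) * ‖z - q‖ ^ 2 + α * ‖S z - q‖ ^ 2 - α * (1 - α) * ‖S z - z‖ ^ 2 := by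
    rw [e, e2, norm_add_sq_real, norm_sub_sq_real (S z - q), norm_smul, norm_smul, real_inner_smul_left,
      real_inner_smul_right, mul_pow, mul_pow, Real.norm_eq_abs, Real.norm_eq_abs, sq_abs, sq_abs,
      real_inner_comm (z - q)]
    ring
  have h1 := mul_le_mul_of_nonneg_left hS hα0
  have h2 : 0 ≤ α * (1 - α) * ‖S z - z‖ ^ 2 :=
    mul_nonneg (mul_nonneg hα0 (sub_nonneg.2 hα1)) (sq_nonneg _)
  linarith

variable {H E : Type*} [NormedAddCommGroup H] [InnerProductSpace ℝ H] [CompleteSpace H]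
  [NormedAddCommGroup E] [InnerProductSpace ℝ E] [CompleteSpace E]

/-- An Opial-type lemma: a bounded sequence with weak cluster points in `F`, which moves away from
a point `q ∈ F` only through a step `τ n` along `A† A`, converges weakly to a zero of `A` in `F`
as soon as `∑ τ n ‖A (z n)‖ ^ 2 < ∞` and `∑ τ n = ∞`. -/
theorem exists_weaklyConverges_of_quasiFejer {A : H →L[ℝ] E} {F : Set H} {τ : ℕ → ℝ} {z : ℕ → H}
    {C : ℝ} (hbdd : ∀ n, ‖z n‖ ≤ C) (hτ : ∀ n, 0 ≤ τ n) (hτsum : ¬ Summable τ)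
    (hA : Summable fun n => τ n * ‖A (z n)‖ ^ 2)
    (hstep : ∀ q ∈ F, ∀ᶠ n in atTop,
      ‖z (n + 1) - q‖ ^ 2 ≤ ‖z n - q‖ ^ 2 + 2 * τ n * ⟪A q, A (z n)⟫_ℝ)
    (hF : ∀ (φ : ℕ → ℕ) (q : H), StrictMono φ → WeaklyConverges (z ∘ φ) q → q ∈ F) :
    ∃ p ∈ F, A p = 0 ∧ WeaklyConverges z p := by
  have hzero : ∀ (φ : ℕ → ℕ), StrictMono φ → Tendsto (fun n => A (z (φ n))) atTop (𝓝 0) →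
      ∃ (p : H) (ψ : ℕ → ℕ), StrictMono ψ ∧ p ∈ F ∧ A p = 0 ∧
        WeaklyConverges (z ∘ (φ ∘ ψ)) p := by
    intro φ hφ h0
    obtain ⟨p, ψ, hψ, hp⟩ := exists_subseq_weaklyConverges (x := z ∘ φ) fun n => hbdd _
    exact ⟨p, ψ, hψ, hF _ p (hφ.comp hψ) hp,
      (hp.map A).eq_zero_of_tendsto (h0.comp hψ.tendsto_atTop), hp⟩
  have hsmall : ∀ {P : ℕ → Prop}, (∀ ε : ℝ, 0 < ε → ∃ᶠ n in atTop, P n ∧ ‖A (z n)‖ < ε) →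
      ∃ φ : ℕ → ℕ, StrictMono φ ∧ (∀ n, P (φ n)) ∧
        Tendsto (fun n => A (z (φ n))) atTop (𝓝 0) := by
    intro P hP
    obtain ⟨φ, hφ, h⟩ := extraction_forall_of_frequently
      (P := fun n k : ℕ => P k ∧ ‖A (z k)‖ < 1 / ((n : ℝ) + 1)) fun n => hP _ (by positivity)
    exact ⟨φ, hφ, fun n => (h n).1, squeeze_zero_norm (fun n => (h n).2.le)
      tendsto_one_div_add_atTop_nhds_zero_nat⟩
  -- Otherwise eventually τ_n ≤ ε⁻² τ_n‖Az_n‖², which would make τ summable.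
  have hfreq : ∀ ε : ℝ, 0 < ε → ∃ᶠ n in atTop, True ∧ ‖A (z n)‖ < ε := by
    intro ε hε hcon
    refine hτsum ?_
    refine (hA.mul_left (ε ^ 2)⁻¹).of_norm_bounded_eventually_nat ?_
    filter_upwards [hcon] with n hn
    have h1 : ε ^ 2 ≤ ‖A (z n)‖ ^ 2 := by
      have : ε ≤ ‖A (z n)‖ := by simpa using hn
      gcongr
    rw [Real.norm_of_nonneg (hτ n), inv_mul_eq_div, le_div_iff₀ (by positivity)]
    exact mul_le_mul_of_nonneg_left h1 (hτ n)
  obtain ⟨φ₀, hφ₀, -, h0⟩ := hsmall hfreq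
  obtain ⟨p, ψ₀, hψ₀, hpF, hAp, hp⟩ := hzero φ₀ hφ₀ h0
  have hlim : ∀ q ∈ F, A q = 0 → ∃ d, Tendsto (fun n => ‖z n - q‖ ^ 2) atTop (𝓝 d) := by
    intro q hq hAq
    refine exists_tendsto_of_eventually_succ_le (fun n => sq_nonneg _) ?_
    filter_upwards [hstep q hq] with n hn
    simpa [hAq] using hn
  obtain ⟨d, hd⟩ := hlim p hpF hAp
  have hsub : ∀ (φ : ℕ → ℕ) (r q : H), StrictMono φ → WeaklyConverges (z ∘ φ) r →
      Tendsto (fun n => ‖z (φ n) - q‖ ^ 2) atTop (𝓝 (d + (‖r - q‖ ^ 2 - ‖r - p‖ ^ 2))) := by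
    intro φ r q hφ hr
    have := (hd.comp hφ.tendsto_atTop).add (hr.tendsto_norm_sq_sub p q)
    simpa using this
  have hφp := hφ₀.comp hψ₀
  refine ⟨p, hpF, hAp, weaklyConverges_of_unique_weak_cluster hbdd fun θ q hθ hq => ?_⟩
  by_contra hne
  have hδ : 0 < ‖p - q‖ ^ 2 := by
    have : p - q ≠ 0 := sub_ne_zero.2 (Ne.symm hne)
    positivity
  set δ := ‖p - q‖ ^ 2 with hδdef
  -- Otherwise some subsequence below this level has Az → 0 and a weak limit r ∈ F ∩ ker A. Both
  -- distances to r and to p converge, so r = p, and then ‖z − q‖² → d + δ along it.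
  have hactive : ∃ ε : ℝ, 0 < ε ∧
      ∀ᶠ n in atTop, ‖z n - q‖ ^ 2 ≤ d + δ / 2 → ε ≤ ‖A (z n)‖ := by
    by_contra! hcon
    obtain ⟨φ, hφ, hle, hA0⟩ := hsmall (P := fun n => ‖z n - q‖ ^ 2 ≤ d + δ / 2) fun ε hε =>
      hcon ε hε
    obtain ⟨r, ψ, hψ, hrF, hAr, hr⟩ := hzero φ hφ hA0
    have hrp : r = p := by
      obtain ⟨d', hd'⟩ := hlim r hrF hAr
      have h1 := tendsto_nhds_unique (hd'.comp hφp.tendsto_atTop) (hsub _ p r hφp hp)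
      have h2 := tendsto_nhds_unique (hd'.comp (hφ.comp hψ).tendsto_atTop)
        (hsub _ r r (hφ.comp hψ) hr)
      rw [norm_sub_rev p r] at h1
      simp only [sub_self, norm_zero] at h1 h2
      have h3 : ‖r - p‖ ^ 2 = 0 := by linarith
      exact sub_eq_zero.1 (norm_eq_zero.1 (pow_eq_zero_iff two_ne_zero |>.1 h3))
    have h := le_of_tendsto' (hsub _ r q (hφ.comp hψ) hr) fun n => hle (ψ n)
    rw [hrp, ← hδdef, sub_self, norm_zero] at h
    linarith
  obtain ⟨ε, hε, hact⟩ := hactive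
  have hqF : q ∈ F := hF θ q hθ hq
  have hgrow : ∀ᶠ n in atTop, ‖z n - q‖ ^ 2 ≤ d + δ / 2 →
      ‖z (n + 1) - q‖ ^ 2 ≤ ‖z n - q‖ ^ 2 + 2 * ‖A q‖ / ε * (τ n * ‖A (z n)‖ ^ 2) := by
    filter_upwards [hact, hstep q hqF] with n hn hs hle
    refine hs.trans (add_le_add_right ?_ _)
    have h1 := real_inner_le_norm (A q) (A (z n))
    have h2 : ‖A (z n)‖ ≤ ‖A (z n)‖ ^ 2 / ε := by
      rw [le_div_iff₀ hε, sq]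
      exact mul_le_mul_of_nonneg_left (hn hle) (norm_nonneg _)
    calc 2 * τ n * ⟪A q, A (z n)⟫_ℝ ≤ 2 * τ n * (‖A q‖ * (‖A (z n)‖ ^ 2 / ε)) := by
          have := hτ n
          gcongr
          exact h1.trans (by gcongr)
      _ = 2 * ‖A q‖ / ε * (τ n * ‖A (z n)‖ ^ 2) := by ring
  -- Along `θ` the limit is d − δ. Hence ‖z − q‖² eventually stays below d + δ/2, against its limit
  -- d + δ along the subsequence converging to p.
  have hlow : ∃ᶠ n in atTop, ‖z n - q‖ ^ 2 < d := by
    have h := hsub θ q q hθ hq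
    rw [norm_sub_rev q p, ← hδdef, sub_self, norm_zero] at h
    exact hθ.tendsto_atTop.frequently (h.eventually_lt_const (by linarith)).frequently
  have hev := eventually_le_of_summable_growth (show d < d + δ / 2 by linarith)
    (hA.mul_left (2 * ‖A q‖ / ε))
    (fun n => mul_nonneg (by positivity) (mul_nonneg (hτ n) (sq_nonneg _))) hgrow hlow
  have h := le_of_tendsto (hsub _ p q hφp hp) (hφp.tendsto_atTop.eventually hev)
  rw [← hδdef, sub_self, norm_zero] at h
  linarith

/-- The first-order terms give −τ(1 + κ)‖Sz − z‖² and −2τ‖Az‖². For small τ the second-order error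
is at most τ‖Sz − z‖² + τ‖Az‖², which leaves half of the gradient decrease. -/
theorem norm_sq_gradient_step_le {S : H → H} {A : H →L[ℝ] E} {κ τ : ℝ} {z q : H} (hτ0 : 0 ≤ τ)
    (hκ : 0 ≤ κ) (hτ : 2 * τ ≤ 1) (hτA : 2 * τ * ‖A‖ ^ 2 ≤ 1)
    (hS : ‖S z - q‖ ^ 2 ≤ ‖z - q‖ ^ 2 - κ * ‖S z - z‖ ^ 2) :
    ‖(1 - τ) • z + τ • S z - τ • ContinuousLinearMap.adjoint A (A z) - q‖ ^ 2 ≤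
      ‖z - q‖ ^ 2 - τ * ‖A z‖ ^ 2 + 2 * τ * ⟪A q, A z⟫_ℝ := by
  set B := ContinuousLinearMap.adjoint A (A z) with hB
  have e : (1 - τ) • z + τ • S z - τ • B - q = (z - q) + τ • ((S z - z) - B) := by module
  have hin : ⟪z - q, B⟫_ℝ = ‖A z‖ ^ 2 - ⟪A q, A z⟫_ℝ := by
    rw [hB, ContinuousLinearMap.adjoint_inner_right, map_sub, inner_sub_left,
      real_inner_self_eq_norm_sq]
  have hS' : 2 * ⟪z - q, S z - z⟫_ℝ + (1 + κ) * ‖S z - z‖ ^ 2 ≤ 0 := by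
    have e2 : S z - q = (z - q) + (S z - z) := by abel
    rw [e2, norm_add_sq_real] at hS
    linarith
  have hBn : ‖B‖ ^ 2 ≤ ‖A‖ ^ 2 * ‖A z‖ ^ 2 := by
    rw [← mul_pow]
    gcongr
    exact ((ContinuousLinearMap.adjoint A).le_opNorm _).trans_eq (by simp)
  have hsq : ‖(S z - z) - B‖ ^ 2 ≤ 2 * ‖S z - z‖ ^ 2 + 2 * ‖B‖ ^ 2 := by
    have := parallelogram_law_with_norm ℝ (S z - z) B
    nlinarith [sq_nonneg ‖(S z - z) + B‖]
  rw [e, norm_add_sq_real, real_inner_smul_right, inner_sub_right, hin, norm_smul, mul_pow,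
    Real.norm_eq_abs, sq_abs]
  have h1 := mul_le_mul_of_nonneg_left hS' hτ0
  have h2 := mul_le_mul_of_nonneg_left hsq (sq_nonneg τ)
  have h3 := mul_le_mul_of_nonneg_left hBn (sq_nonneg τ)
  have h4 := mul_le_mul_of_nonneg_right hτ (mul_nonneg hτ0 (sq_nonneg ‖S z - z‖))
  have h5 := mul_le_mul_of_nonneg_right hτA (mul_nonneg hτ0 (sq_nonneg ‖A z‖))
  have h6 := mul_nonneg (mul_nonneg hτ0 hκ) (sq_nonneg ‖S z - z‖)
  linarith

/-- Weak convergence of a relaxed fixed point iteration that is perturbed by vanishing gradient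
steps for `‖A z‖ ^ 2 / 2`. -/
theorem exists_weaklyConverges_relaxed_gradient {S : H → H} {A : H →L[ℝ] E} {F : Set H}
    {κ a : ℝ} (hκ : 0 < κ) (ha : 0 < a)
    (hS : ∀ z, ∀ q ∈ F, ‖S z - q‖ ^ 2 ≤ ‖z - q‖ ^ 2 - κ * ‖S z - z‖ ^ 2)
    (hdemi : ∀ (x : ℕ → H) (p : H), WeaklyConverges x p →
      Tendsto (fun n => S (x n) - x n) atTop (𝓝 0) → p ∈ F)
    (hΓ : ∃ p ∈ F, A p = 0) {α τ : ℕ → ℝ} (hα : ∀ n, a < α n ∧ α n < 1) (hτ : ∀ n, 0 < τ n)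
    (hτ0 : Tendsto τ atTop (𝓝 0))
    (hτsum : Tendsto (fun N => ∑ n ∈ Finset.range N, τ n) atTop atTop) {z v : ℕ → H}
    (hv : ∀ n, v n = (1 - τ n) • z n + τ n • S (z n) -
      τ n • ContinuousLinearMap.adjoint A (A (z n)))
    (hz : ∀ n, z (n + 1) = (1 - α n) • v n + α n • S (v n)) :
    ∃ p ∈ F, A p = 0 ∧ WeaklyConverges z p := by
  obtain ⟨p₀, hp₀, hAp₀⟩ := hΓ
  have hsmall : ∀ᶠ n in atTop, 2 * τ n ≤ 1 ∧ 2 * τ n * ‖A‖ ^ 2 ≤ 1 := by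
    have h1 : Tendsto (fun n => 2 * τ n) atTop (𝓝 0) := by simpa using hτ0.const_mul 2
    have h2 : Tendsto (fun n => 2 * τ n * ‖A‖ ^ 2) atTop (𝓝 0) := by
      simpa using h1.mul_const (‖A‖ ^ 2)
    exact (h1.eventually_le_const one_pos).and (h2.eventually_le_const one_pos)
  obtain ⟨N, hN⟩ := eventually_atTop.1 hsmall
  have hmain : ∀ q ∈ F, ∀ n, N ≤ n → ‖z (n + 1) - q‖ ^ 2 + a * κ * ‖S (v n) - v n‖ ^ 2 +
      τ n * ‖A (z n)‖ ^ 2 ≤ ‖z n - q‖ ^ 2 + 2 * τ n * ⟪A q, A (z n)⟫_ℝ := by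
    intro q hq n hn
    have h1 := norm_sq_relaxed_sub_le (ha.trans (hα n).1).le (hα n).2.le (hS (v n) q hq)
    have h2 := norm_sq_gradient_step_le (A := A) (hτ n).le hκ.le (hN n hn).1 (hN n hn).2
      (hS (z n) q hq)
    rw [← hz n] at h1
    rw [← hv n] at h2
    have h3 : a * κ * ‖S (v n) - v n‖ ^ 2 ≤ α n * κ * ‖S (v n) - v n‖ ^ 2 := by
      gcongr
      exact (hα n).1.le
    linarith
  have hdec : ∀ n, N ≤ n → ‖z (n + 1) - p₀‖ ^ 2 + a * κ * ‖S (v n) - v n‖ ^ 2 +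
      τ n * ‖A (z n)‖ ^ 2 ≤ ‖z n - p₀‖ ^ 2 := fun n hn => by
    simpa [hAp₀] using hmain p₀ hp₀ n hn
  have hsumA0 : ∀ n, 0 ≤ τ n * ‖A (z n)‖ ^ 2 := fun n => mul_nonneg (hτ n).le (sq_nonneg _)
  have hres0 : ∀ n, 0 ≤ a * κ * ‖S (v n) - v n‖ ^ 2 := fun n => by positivity
  have hsum : Summable fun n => a * κ * ‖S (v n) - v n‖ ^ 2 + τ n * ‖A (z n)‖ ^ 2 := by
    refine (summable_nat_add_iff N).1 ?_
    refine summable_of_sum_range_le (c := ‖z N - p₀‖ ^ 2)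
      (fun n => add_nonneg (hres0 _) (hsumA0 _)) fun m => ?_
    have h : ∀ m, ∑ n ∈ Finset.range m, (a * κ * ‖S (v (n + N)) - v (n + N)‖ ^ 2 +
        τ (n + N) * ‖A (z (n + N))‖ ^ 2) ≤ ‖z N - p₀‖ ^ 2 - ‖z (m + N) - p₀‖ ^ 2 := by
      intro m
      induction m with
      | zero => simp
      | succ m ih =>
        have := hdec (m + N) (by omega)
        rw [Finset.sum_range_succ, show m + 1 + N = m + N + 1 by omega]
        linarith
    exact (h m).trans (sub_le_self _ (sq_nonneg _))
  have hsumA : Summable fun n => τ n * ‖A (z n)‖ ^ 2 :=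
    hsum.of_nonneg_of_le hsumA0 fun n => le_add_of_nonneg_left (hres0 n)
  have hres : Tendsto (fun n => S (v n) - v n) atTop (𝓝 0) := by
    have h1 : Summable fun n => a * κ * ‖S (v n) - v n‖ ^ 2 :=
      hsum.of_nonneg_of_le hres0 fun n => le_add_of_nonneg_right (hsumA0 n)
    have h2 := ((summable_mul_left_iff (mul_pos ha hκ).ne').1 h1).tendsto_atTop_zero.sqrt
    rw [Real.sqrt_zero] at h2
    refine tendsto_zero_iff_norm_tendsto_zero.2 (h2.congr fun n => ?_)
    exact Real.sqrt_sq (norm_nonneg _)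
  obtain ⟨d, hd⟩ := exists_tendsto_of_eventually_succ_le (g := fun n => ‖z n - p₀‖ ^ 2)
    (fun n => sq_nonneg _) (eventually_atTop.2 ⟨N, fun n hn => by
      linarith [hdec n hn, hres0 n, hsumA0 n]⟩)
  obtain ⟨D, hD⟩ := hd.bddAbove_range
  have hzp : ∀ n, ‖z n - p₀‖ ≤ Real.sqrt D := fun n =>
    Real.le_sqrt_of_sq_le (hD ⟨n, rfl⟩)
  have hbdd : ∀ n, ‖z n‖ ≤ Real.sqrt D + ‖p₀‖ := fun n => by
    have := norm_add_le (z n - p₀) p₀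
    rw [sub_add_cancel] at this
    linarith [hzp n]
  have hvz : Tendsto (fun n => v n - z n) atTop (𝓝 0) := by
    have hbound : ∀ n, ‖v n - z n‖ ≤
        τ n * (2 * Real.sqrt D + ‖A‖ * (‖A‖ * (Real.sqrt D + ‖p₀‖))) := by
      intro n
      have e : v n - z n = τ n • ((S (z n) - p₀) - (z n - p₀)
          - ContinuousLinearMap.adjoint A (A (z n))) := by
        rw [hv n]; module
      have h1 : ‖S (z n) - p₀‖ ≤ ‖z n - p₀‖ := by
        refine le_of_sq_le_sq ((hS (z n) p₀ hp₀).trans ?_) (norm_nonneg _)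
        have : 0 ≤ κ * ‖S (z n) - z n‖ ^ 2 := by positivity
        linarith
      have h2 : ‖ContinuousLinearMap.adjoint A (A (z n))‖ ≤
          ‖A‖ * (‖A‖ * (Real.sqrt D + ‖p₀‖)) := by
        refine ((ContinuousLinearMap.adjoint A).le_opNorm _).trans ?_
        rw [LinearIsometryEquiv.norm_map]
        gcongr
        exact (A.le_opNorm _).trans (by gcongr; exact hbdd n)
      rw [e, norm_smul, Real.norm_of_nonneg (hτ n).le]
      refine mul_le_mul_of_nonneg_left ?_ (hτ n).le
      have h3 := norm_sub_le ((S (z n) - p₀) - (z n - p₀))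
        (ContinuousLinearMap.adjoint A (A (z n)))
      have h4 := norm_sub_le (S (z n) - p₀) (z n - p₀)
      linarith [hzp n]
    exact squeeze_zero_norm hbound (by simpa using hτ0.mul_const _)
  refine exists_weaklyConverges_of_quasiFejer hbdd (fun n => (hτ n).le) ?_ hsumA ?_ ?_
  · rw [not_summable_iff_tendsto_nat_atTop_of_nonneg fun n => (hτ n).le]
    exact hτsum
  · intro q hq
    filter_upwards [eventually_ge_atTop N] with n hn
    linarith [hmain q hq n hn, hres0 n, hsumA0 n]
  · intro φ q hφ hq
    -- The vanishing residual is that of `v`, which shares its weak limits with `z` because v − z →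
    -- 0.
    exact hdemi (v ∘ φ) q (hq.of_sub_tendsto_zero (hvz.comp hφ.tendsto_atTop))
      (hres.comp hφ.tendsto_atTop)

end Convergence

/-! ### Ishikawa-type maps of nonexpansive maps. -/

section Ishikawa

variable {H : Type*} [NormedAddCommGroup H] [InnerProductSpace ℝ H]

/-- The inner average y satisfies ‖Ry − p‖ ≤ ‖x − p‖, and moving from x a fraction η towards Ry
gains η(1 − η)‖Ry − x‖². -/
theorem norm_sq_ishikawaMap_sub_le {R : H → H} (hR : ∀ x y, ‖R x - R y‖ ≤ ‖x - y‖) {η ζ : ℝ}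
    (hη0 : 0 < η) (hζ0 : 0 ≤ ζ) (hζ1 : ζ ≤ 1) {p : H} (hp : R p = p) (x : H) :
    ‖ishikawaMap η ζ R x - p‖ ^ 2 ≤
      ‖x - p‖ ^ 2 - (1 - η) / η * ‖ishikawaMap η ζ R x - x‖ ^ 2 := by
  set y := (1 - ζ) • x + ζ • R x with hy
  have hRp : ∀ z, ‖R z - p‖ ≤ ‖z - p‖ := fun z => by simpa [hp] using hR z p
  have hyp : ‖y - p‖ ≤ ‖x - p‖ := by
    have e : y - p = (1 - ζ) • (x - p) + ζ • (R x - p) := by rw [hy]; module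
    calc ‖y - p‖ ≤ (1 - ζ) * ‖x - p‖ + ζ * ‖R x - p‖ := by
          rw [e]
          refine (norm_add_le _ _).trans_eq ?_
          rw [norm_smul, norm_smul, Real.norm_of_nonneg (sub_nonneg.2 hζ1),
            Real.norm_of_nonneg hζ0]
      _ ≤ (1 - ζ) * ‖x - p‖ + ζ * ‖x - p‖ := by gcongr; exact hRp x
      _ = ‖x - p‖ := by ring
  have hW : ‖R y - p‖ ^ 2 ≤ ‖x - p‖ ^ 2 := by
    gcongr
    exact (hRp y).trans hyp
  have e1 : ishikawaMap η ζ R x - p = (x - p) + η • (R y - x) := by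
    unfold ishikawaMap; rw [← hy]; module
  have e2 : ishikawaMap η ζ R x - x = η • (R y - x) := by
    unfold ishikawaMap; rw [← hy]; module
  have e3 : R y - p = (x - p) + (R y - x) := by abel
  rw [e3, norm_add_sq_real] at hW
  rw [e1, e2, norm_add_sq_real, real_inner_smul_right, norm_smul, Real.norm_of_nonneg hη0.le]
  have h := mul_le_mul_of_nonneg_left hW hη0.le
  have e4 : (1 - η) / η * (η * ‖R y - x‖) ^ 2 = (1 - η) * η * ‖R y - x‖ ^ 2 := by
    field_simp
  rw [e4]
  linarith

/-- The residual of a nonexpansive map is controlled by the one of its Ishikawa-type map. -/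
theorem norm_sub_self_le_ishikawaMap {R : H → H} (hR : ∀ x y, ‖R x - R y‖ ≤ ‖x - y‖) {η ζ : ℝ}
    (hη0 : 0 < η) (hζ0 : 0 ≤ ζ) (hζ1 : ζ < 1) (x : H) :
    ‖R x - x‖ ≤ (η * (1 - ζ))⁻¹ * ‖ishikawaMap η ζ R x - x‖ := by
  set y := (1 - ζ) • x + ζ • R x with hy
  have e2 : ishikawaMap η ζ R x - x = η • (R y - x) := by
    unfold ishikawaMap; rw [← hy]; module
  have e3 : x - y = ζ • (x - R x) := by rw [hy]; module
  have h1 : ‖R x - R y‖ ≤ ζ * ‖R x - x‖ := by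
    refine (hR x y).trans_eq ?_
    rw [e3, norm_smul, Real.norm_of_nonneg hζ0, norm_sub_rev]
  have h2 : ‖R x - x‖ ≤ ‖R x - R y‖ + ‖R y - x‖ := norm_sub_le_norm_sub_add_norm_sub _ _ _
  have hζ' : 0 < 1 - ζ := sub_pos.2 hζ1
  rw [inv_mul_eq_div, le_div_iff₀ (by positivity), e2, norm_smul, Real.norm_of_nonneg hη0.le]
  have h3 : (1 - ζ) * ‖R x - x‖ ≤ ‖R y - x‖ := by linarith
  linarith [mul_le_mul_of_nonneg_left h3 hη0.le]

theorem fixedPoint_of_tendsto_ishikawaMap {R : H → H} (hR : ∀ x y, ‖R x - R y‖ ≤ ‖x - y‖)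
    {η ζ : ℝ} (hη0 : 0 < η) (hζ0 : 0 ≤ ζ) (hζ1 : ζ < 1)
    (hdemi : DemiclosedAtZero fun x => R x - x) {x : ℕ → H} {p : H} (hx : WeaklyConverges x p)
    (h0 : Tendsto (fun n => ishikawaMap η ζ R (x n) - x n) atTop (𝓝 0)) : R p = p :=
  sub_eq_zero.1 (hdemi x p hx (squeeze_zero_norm
    (fun n => norm_sub_self_le_ishikawaMap hR hη0 hζ0 hζ1 (x n))
    (by simpa using h0.norm.const_mul (η * (1 - ζ))⁻¹)))

end Ishikawa

/-! ### The coupling constraint as a kernel on the Hilbert product. -/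

section Product

variable {H₁ H₂ H₃ : Type*}
  [NormedAddCommGroup H₁] [InnerProductSpace ℝ H₁]
  [NormedAddCommGroup H₂] [InnerProductSpace ℝ H₂]
  [NormedAddCommGroup H₃] [InnerProductSpace ℝ H₃]

/-- The map `(x, y) ↦ D₁ x - D₂ y` on the Hilbert product. -/
noncomputable def differenceMap (D₁ : H₁ →L[ℝ] H₃) (D₂ : H₂ →L[ℝ] H₃) :
    WithLp 2 (H₁ × H₂) →L[ℝ] H₃ :=
  D₁ ∘L WithLp.fstL 2 ℝ H₁ H₂ - D₂ ∘L WithLp.sndL 2 ℝ H₁ H₂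

theorem differenceMap_apply (D₁ : H₁ →L[ℝ] H₃) (D₂ : H₂ →L[ℝ] H₃) (z : WithLp 2 (H₁ × H₂)) :
    differenceMap D₁ D₂ z = D₁ z.fst - D₂ z.snd := rfl

theorem adjoint_differenceMap_apply [CompleteSpace H₁] [CompleteSpace H₂] [CompleteSpace H₃]
    (D₁ : H₁ →L[ℝ] H₃) (D₂ : H₂ →L[ℝ] H₃) (e : H₃) :
    ContinuousLinearMap.adjoint (differenceMap D₁ D₂) e = WithLp.toLp 2
      (ContinuousLinearMap.adjoint D₁ e, -ContinuousLinearMap.adjoint D₂ e) := by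
  refine ext_inner_left ℝ fun z => ?_
  rw [ContinuousLinearMap.adjoint_inner_right, differenceMap_apply, WithLp.prod_inner_apply,
    inner_neg_right, ContinuousLinearMap.adjoint_inner_right,
    ContinuousLinearMap.adjoint_inner_right, inner_sub_left]
  rfl

end Product

end SplitVI

/-! ### The main theorem, by reduction to one iteration on the product. -/

open SplitVI ContinuousLinearMap in
theorem theorem4p2
    {H₁ H₂ H₃ : Type*}
    [NormedAddCommGroup H₁] [InnerProductSpace ℝ H₁] [CompleteSpace H₁]
    [NormedAddCommGroup H₂] [InnerProductSpace ℝ H₂] [CompleteSpace H₂]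
    [NormedAddCommGroup H₃] [InnerProductSpace ℝ H₃] [CompleteSpace H₃]
    (K₁ : Set H₁) (hK₁ : K₁.Nonempty) (hK₁c : IsClosed K₁) (hK₁v : Convex ℝ K₁)
    (K₂ : Set H₂) (hK₂ : K₂.Nonempty) (hK₂c : IsClosed K₂) (hK₂v : Convex ℝ K₂)
    (T₁ : H₁ → H₁) (hT₁ : IsMonotoneOperatorOn T₁ K₁) (hT₁c : IsRadiallyContinuousOn T₁ K₁)
    (T₂ : H₂ → H₂) (hT₂ : IsMonotoneOperatorOn T₂ K₂) (hT₂c : IsRadiallyContinuousOn T₂ K₂)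
    (D₁ : H₁ →L[ℝ] H₃) (D₂ : H₂ →L[ℝ] H₃)
    (lam : ℝ) (hlam : 0 < lam)
    (R₁ : H₁ → H₁) (hR₁ : R₁ = resolventMap lam K₁ (viBifunction T₁))
    (R₂ : H₂ → H₂) (hR₂ : R₂ = resolventMap lam K₂ (viBifunction T₂))
    (hdemi₁ : DemiclosedAtZero fun x => R₁ x - x)
    (hdemi₂ : DemiclosedAtZero fun y => R₂ y - y)
    (hΓ : (svipSolutions K₁ K₂ T₁ T₂ D₁ D₂).Nonempty)
    (η ζ : ℝ) (hη : 0 < η) (hηζ : η < ζ) (hζ : ζ < 1 / (1 + Real.sqrt (1 + 1 ^ 2)))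
    (U : H₁ → H₁) (hU : U = ishikawaMap η ζ R₁)
    (V : H₂ → H₂) (hV : V = ishikawaMap η ζ R₂)
    (a : ℝ) (ha : 0 < a) (α : ℕ → ℝ) (hα : ∀ n, a < α n ∧ α n < 1)
    (τ : ℕ → ℝ) (hτ : ∀ n, 0 < τ n)
    (hτL : ∀ n, τ n * (‖adjoint D₁ ∘L D₁‖ + ‖adjoint D₂ ∘L D₂‖) < 2)
    (hτ0 : Tendsto τ atTop (𝓝 0))
    (hτsum : Tendsto (fun N => ∑ n ∈ Finset.range N, τ n) atTop atTop)
    (x v : ℕ → H₁) (y w : ℕ → H₂)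
    (hv : ∀ n, v n = (1 - τ n) • x n + τ n • U (x n) + τ n • adjoint D₁ (D₂ (y n) - D₁ (x n)))
    (hx : ∀ n, x (n + 1) = (1 - α n) • v n + α n • U (v n))
    (hw : ∀ n, w n = (1 - τ n) • y n + τ n • V (y n) + τ n • adjoint D₂ (D₁ (x n) - D₂ (y n)))
    (hy : ∀ n, y (n + 1) = (1 - α n) • w n + α n • V (w n)) :
    (∀ q, resolventValues lam K₁ (viBifunction T₁) q = {R₁ q}) ∧
    (∀ q, resolventValues lam K₂ (viBifunction T₂) q = {R₂ q}) ∧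
    svipSolutions K₁ K₂ T₁ T₂ D₁ D₂ = sefppSolutions R₁ R₂ D₁ D₂ ∧
    ∃ p ∈ svipSolutions K₁ K₂ T₁ T₂ D₁ D₂, WeaklyConverges x p.1 ∧ WeaklyConverges y p.2 := by
  have hres₁ : ∀ q, resolventValues lam K₁ (viBifunction T₁) q = {R₁ q} := fun q =>
    hR₁ ▸ resolventValues_eq_singleton hK₁ hK₁c hK₁v hT₁ hT₁c hlam q
  have hres₂ : ∀ q, resolventValues lam K₂ (viBifunction T₂) q = {R₂ q} := fun q =>
    hR₂ ▸ resolventValues_eq_singleton hK₂ hK₂c hK₂v hT₂ hT₂c hlam q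
  have hfix₁ : ∀ q, q ∈ viSolutions K₁ T₁ ↔ R₁ q = q := fun q => by
    rw [← mem_resolventValues_self_iff (lam := lam), hres₁, Set.mem_singleton_iff, eq_comm]
  have hfix₂ : ∀ q, q ∈ viSolutions K₂ T₂ ↔ R₂ q = q := fun q => by
    rw [← mem_resolventValues_self_iff (lam := lam), hres₂, Set.mem_singleton_iff, eq_comm]
  have hne₁ : ∀ q q', ‖R₁ q - R₁ q'‖ ≤ ‖q - q'‖ := fun q q' =>
    norm_sub_le_of_mem_resolventValues hT₁ hlam (by simp [hres₁]) (by simp [hres₁])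
  have hne₂ : ∀ q q', ‖R₂ q - R₂ q'‖ ≤ ‖q - q'‖ := fun q q' =>
    norm_sub_le_of_mem_resolventValues hT₂ hlam (by simp [hres₂]) (by simp [hres₂])
  refine ⟨hres₁, hres₂, ?_, ?_⟩
  · ext p
    simp only [svipSolutions, sefppSolutions, Set.mem_ofPred_eq, hfix₁, hfix₂,
      Function.mem_fixedPoints_iff]
  have hζ1 : ζ < 1 := hζ.trans_le (by
    rw [div_le_one (by positivity)]
    exact le_add_of_nonneg_right (Real.sqrt_nonneg _))
  have hζ0 : 0 ≤ ζ := (hη.trans hηζ).le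
  have hη1 : η < 1 := hηζ.trans hζ1
  let S : WithLp 2 (H₁ × H₂) → WithLp 2 (H₁ × H₂) := fun z => WithLp.toLp 2 (U z.fst, V z.snd)
  let F : Set (WithLp 2 (H₁ × H₂)) := {z | R₁ z.fst = z.fst ∧ R₂ z.snd = z.snd}
  have hS : ∀ z, ∀ q ∈ F, ‖S z - q‖ ^ 2 ≤ ‖z - q‖ ^ 2 - (1 - η) / η * ‖S z - z‖ ^ 2 := by
    intro z q hq
    have h1 := norm_sq_ishikawaMap_sub_le hne₁ hη hζ0 hζ1.le hq.1 z.fst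
    have h2 := norm_sq_ishikawaMap_sub_le hne₂ hη hζ0 hζ1.le hq.2 z.snd
    rw [← hU] at h1
    rw [← hV] at h2
    simp only [WithLp.prod_norm_sq_eq_of_L2, WithLp.sub_fst, WithLp.sub_snd, S, WithLp.toLp_fst, WithLp.toLp_snd]
    linarith
  have hdemi : ∀ (u : ℕ → WithLp 2 (H₁ × H₂)) (p : WithLp 2 (H₁ × H₂)), WeaklyConverges u p →
      Tendsto (fun n => S (u n) - u n) atTop (𝓝 0) → p ∈ F := by
    intro u p hu h0
    have h1 := ((WithLp.fstL 2 ℝ H₁ H₂).continuous.tendsto 0).comp h0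
    have h2 := ((WithLp.sndL 2 ℝ H₁ H₂).continuous.tendsto 0).comp h0
    rw [map_zero] at h1 h2
    subst hU hV
    exact ⟨fixedPoint_of_tendsto_ishikawaMap hne₁ hη hζ0 hζ1 hdemi₁
        (hu.map (WithLp.fstL 2 ℝ H₁ H₂)) h1,
      fixedPoint_of_tendsto_ishikawaMap hne₂ hη hζ0 hζ1 hdemi₂
        (hu.map (WithLp.sndL 2 ℝ H₁ H₂)) h2⟩
  obtain ⟨p, hpF, hAp, hp⟩ := exists_weaklyConverges_relaxed_gradient (S := S) (F := F)
    (A := differenceMap D₁ D₂) (z := fun n => WithLp.toLp 2 (x n, y n))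
    (v := fun n => WithLp.toLp 2 (v n, w n)) (div_pos (sub_pos.2 hη1) hη) ha hS hdemi
    (by
      obtain ⟨⟨p, q⟩, hp, hq, hpq⟩ := hΓ
      exact ⟨WithLp.toLp 2 (p, q), ⟨(hfix₁ p).1 hp, (hfix₂ q).1 hq⟩, sub_eq_zero.2 hpq⟩)
    hα hτ hτ0 hτsum
    -- The sign in the second component of A* makes −τ_n A*Az reproduce both correction terms.
    (fun n => by
      rw [adjoint_differenceMap_apply, differenceMap_apply]
      have e₁ : v n = (1 - τ n) • x n + τ n • U (x n) -
          τ n • adjoint D₁ (D₁ (x n) - D₂ (y n)) := by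
        rw [hv n, ← neg_sub (D₁ (x n)), map_neg, smul_neg, ← sub_eq_add_neg]
      have e₂ : w n = (1 - τ n) • y n + τ n • V (y n) -
          τ n • -adjoint D₂ (D₁ (x n) - D₂ (y n)) := by
        rw [hw n, smul_neg, sub_neg_eq_add]
      rw [e₁, e₂]
      rfl)
    (fun n => by
      rw [hx n, hy n]
      rfl)
  exact ⟨(p.fst, p.snd), ⟨(hfix₁ _).2 hpF.1, (hfix₂ _).2 hpF.2, sub_eq_zero.1 hAp⟩,
    hp.map (WithLp.fstL 2 ℝ H₁ H₂), hp.map (WithLp.sndL 2 ℝ H₁ H₂)⟩
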